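/- Let $F_0 = 0$, $F_1 = 1$ and $F_n = F_{n-1} + F_{n-2}$ for $n \ge 2$ be the Fibonacci numbers. Every natural number $n$ has a unique Fibonacci (Zeckendorf) representation, as a sum of distinct, pairwise non-consecutive Fibonacci numbers $F_k$ with indices $k \ge 2$ (the empty sum for $n = 0$). Let $\mathbf{ftm} = (\mathbf{ftm}[n])_{n \ge 0}$ be the Fibonacci–Thue–Morse sequence: $\mathbf{ftm}[n] \in \{0,1\}$ is the number of summands in this representation (that is, the sum of its bits), taken modulo $2$. Let $\rho(n)$ be the subword complexity of $\mathbf{ftm}$, i.e. the number of distinct blocks $\mathbf{ftm}[i]\,\mathbf{ftm}[i+1]\cdots\mathbf{ftm}[i+n-1]$, $i \ge 0$, of length $n$, and let $d(n) = \rho(n+1) - \rho(n)$. Then for every integer $m \ge 2$ and every natural number $n$: \begin{align*} d(n) &= 8 \quad\text{if } F_{2m+1} + 2 \le n \le F_{2m+1} + F_{2m-2} + 1,\\ d(n) &= 6 \quad\text{if } F_{2m+1} + F_{2m-2} + 2 \le n \le F_{2m+2},\\ d(n) &= 8 \quad\text{if } F_{2m+2} + 1 \le n \le F_{2m+2} +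 F_{2m-1},\\ d(n) &= 6 \quad\text{if } F_{2m+2} + F_{2m-1} + 1 \le n \le F_{2m+3} + 1. \end{align*} -/

import Mathlib

/-- The Fibonacci-Thue-Morse sequence: the sum, modulo 2, of the bits of the Fibonacci
(Zeckendorf) representation of `n`. The list `Nat.zeckendorf n` consists of the indices `k ≥ 2`
of the Fibonacci numbers `Nat.fib k` that occur in the representation, i.e. of the positions of
its bits `1`, so that the sum of the bits is the length of this list. -/
def ftm (n : ℕ) : ZMod 2 := ((Nat.zeckendorf n).length : ZMod 2)

/-- The length-`n` contiguous block `s[i..i+n-1]` of the sequence `s`. -/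
def block {α : Type*} (s : ℕ → α) (n i : ℕ) : Fin n → α := fun t => s (i + t)

/-- The subword complexity of a sequence `s` over a finite alphabet: the number of distinct
length-`n` contiguous blocks that appear in `s`. -/
noncomputable def subwordComplexity {α : Type*} [Finite α] (s : ℕ → α) (n : ℕ) : ℕ :=
  (Set.range (block s n)).ncard

/-- The first difference of the subword complexity of the Fibonacci-Thue-Morse sequence
(an integer, so that the subtraction is not truncated). -/
noncomputable def ftmDiff (n : ℕ) : ℤ :=
  (subwordComplexity ftm (n + 1) : ℤ) - (subwordComplexity ftm n : ℤ)

/-!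
Let `y i = ftm (i + 1) - ftm i`. Adding a large Fibonacci number to `i` flips `ftm` and keeps `y`,
so a block of `ftm` of length `n + 1` is a free choice of first value together with a block of `y`
of length `n`; hence `d(n + 1)` is twice the first difference at `n` of the complexity of `y`.

The value `y i` depends only on the number `t` of trailing zeros in the Zeckendorf representation
of `i + 1`: it is `1`, `0`, `0`, `1` according to `t` modulo 4. Recording also whether `t = 0`
gives a word over three letters, `b` (for `t = 0`) and `a₀`, `a₁` (for `t > 0`, with the value of
`y` as index), whose finite prefixes are built by a Fibonacci recursion and which is invariant under
the substitution `a₀ ↦ a₁ b a₀`, `a₁ ↦ a₀ b a₀`, `b ↦ a₀ b`, up to a shift by two places.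
Factors of length at least 4 can be recovered from `y`, so it suffices to count the right special
factors of the three-letter word (`ftmDiff_succ`).

A long right special factor can be desubstituted: it is a suffix of the image of a right special
factor, possibly extended by `b a₀` (`Special.exists_desubst`). Starting from the right special
factors of length at most 13, found by inspection, this shows that those of length at most
`F (2k + 7)` are the suffixes of three words of exactly that length, the trunks, and of two shorter
words per generation, the twigs (`Special.classification`). The five words of generation `k` are the
images of those of generation `k - 1`, one of them extended by `b a₀`, so the lengths of their
longest common suffixes obey Fibonacci recursions as well: two of the trunks share a suffix of
length `F (2k + 6) - 1`, and every other pair has separated by length `F (2k + 5) + 1`. Counting the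
distinct suffixes of length `N` gives 4 or 3, according to which twigs are at least as long as `N`
and whether the two trunks have separated (`ncard_special`).

All words are written from right to left, so that "suffix" becomes "prefix", the letter following a
factor becomes its head, and the induction on lists proceeds towards the past.
-/

namespace FibThueMorse

/-! ### The substitution and the standard words -/

/-- The letter at position `i ≥ 1` is `b` if the Zeckendorf representation of `i` contains
`F 2 = 1`, and otherwise `a₀` or `a₁`, the index being `ftm i - ftm (i - 1)`. -/
inductive Letter
  | a₀
  | a₁
  | b
  deriving DecidableEq

open Letter

/-- The substitution `a₀ ↦ a₁ b a₀`, `a₁ ↦ a₀ b a₀`, `b ↦ a₀ b` on letters, with its images written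
from right to left. -/
def substLetter : Letter → List Letter
  | a₀ => [a₀, b, a₁]
  | a₁ => [a₀, b, a₀]
  | b => [b, a₀]

/-- The extension of `substLetter` to words; being a morphism on reversed words as well, it needs no
reversal of the argument. -/
def subst (w : List Letter) : List Letter := w.flatMap substLetter

@[simp] lemma subst_nil : subst [] = [] := rfl

@[simp] lemma subst_cons (c : Letter) (w : List Letter) :
    subst (c :: w) = substLetter c ++ subst w := by
  simp [subst]

@[simp] lemma subst_append (v w : List Letter) : subst (v ++ w) = subst v ++ subst w := by
  simp [subst]

lemma subst_prefix {v w : List Letter} (h : v <+: w) : subst v <+: subst w := by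
  obtain ⟨t, rfl⟩ := h
  simp

lemma subst_infix {v w : List Letter} (h : v <:+: w) : subst v <:+: subst w := by
  obtain ⟨s, t, rfl⟩ := h
  exact ⟨subst s, subst t, by simp⟩

/-- The letter at position `F (n + 3)`, whose number of trailing zeros is `n + 1`. -/
def hole : ℕ → Letter
  | 0 => a₀
  | 1 => a₀
  | 2 => a₁
  | 3 => a₁
  | n + 4 => hole n

lemma hole_cases (n : ℕ) : (hole n = a₀ ∧ hole (n + 2) = a₁) ∨
    (hole n = a₁ ∧ hole (n + 2) = a₀) := by
  induction n using hole.induct with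
  | case5 n ih => simpa [hole] using ih
  | _ => simp [hole]

lemma substLetter_hole (n : ℕ) : substLetter (hole n) = [a₀, b, hole (n + 2)] := by
  rcases hole_cases n with ⟨h, h'⟩ | ⟨h, h'⟩ <;> rw [h, h'] <;> rfl

/-- The letters at the positions `F (n + 2) - 1, …, 2, 1`, in this order. The recursion reflects
that adding `F (n + 3)` does not change the letter at a position below `F (n + 2)`. -/
def stdWord : ℕ → List Letter
  | 0 => []
  | 1 => [b]
  | n + 2 => stdWord n ++ hole n :: stdWord (n + 1)

lemma stdWord_add_two (n : ℕ) : stdWord (n + 2) = stdWord n ++ hole n :: stdWord (n + 1) := rfl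

lemma stdWord_add_two_eq_subst (n : ℕ) : stdWord (n + 2) = subst (stdWord n) ++ [a₀, b] := by
  induction n using Nat.twoStepInduction with
  | zero => rfl
  | one => rfl
  | more n ih₁ ih₂ =>
    rw [stdWord_add_two (n + 2), ih₂]
    nth_rw 1 [ih₁]
    rw [stdWord_add_two n]
    simp [substLetter_hole]

lemma stdWord_suffix_succ (n : ℕ) : stdWord n <:+ stdWord (n + 1) := by
  cases n with
  | zero => exact List.nil_suffix
  | succ n => exact ⟨stdWord n ++ [hole n], by simp [stdWord_add_two]⟩

lemma stdWord_suffix {m n : ℕ} (h : m ≤ n) : stdWord m <:+ stdWord n := by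
  induction n, h using Nat.le_induction with
  | base => exact List.suffix_rfl
  | succ n _ ih => exact ih.trans (stdWord_suffix_succ n)

lemma stdWord_prefix_add_two_mul (n k : ℕ) : stdWord n <+: stdWord (n + 2 * k) := by
  induction k with
  | zero => exact List.prefix_rfl
  | succ k ih =>
    refine ih.trans ?_
    rw [show n + 2 * (k + 1) = n + 2 * k + 2 by ring, stdWord_add_two]
    exact List.prefix_append _ _

lemma hole_add_four_mul (n k : ℕ) : hole (n + 4 * k) = hole n := by
  induction k with
  | zero => rfl
  | succ k ih => rw [show n + 4 * (k + 1) = n + 4 * k + 4 by ring, hole, ih]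

/-! ### Factors -/

/-- `w` is a factor, written from right to left, of the infinite three-letter word. -/
def Lang (w : List Letter) : Prop := ∃ n, w <:+: stdWord n

lemma Lang.of_infix {v w : List Letter} (hw : Lang w) (h : v <:+: w) : Lang v :=
  hw.imp fun _ hn => h.trans hn

lemma Lang.of_cons {c : Letter} {w : List Letter} (h : Lang (c :: w)) : Lang w :=
  h.of_infix (List.suffix_cons c w).isInfix

/-- A standard word occurs, in reading order, after `a₀` and after `a₁`. -/
lemma lang_stdWord_append_a (n : ℕ) :
    Lang (stdWord n ++ [a₀]) ∧ Lang (stdWord n ++ [a₁]) := by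
  have h₁ : Lang (stdWord n ++ [hole n]) :=
    ⟨n + 2, [], stdWord (n + 1), by simp [stdWord_add_two]⟩
  have h₂ : Lang (stdWord n ++ [hole (n + 2)]) := by
    obtain ⟨s, hs⟩ := stdWord_suffix (Nat.le_add_right n 2)
    exact ⟨n + 4, s, stdWord (n + 3), by simp [stdWord_add_two (n + 2), ← hs]⟩
  rcases hole_cases n with ⟨h, h'⟩ | ⟨h, h'⟩ <;> rw [h] at h₁ <;> rw [h'] at h₂
  exacts [⟨h₁, h₂⟩, ⟨h₂, h₁⟩]

lemma Lang.exists_append {w : List Letter} (h : Lang w) : ∃ c, Lang (w ++ [c]) := by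
  obtain ⟨n, s, t, hn⟩ := h
  cases t with
  | nil =>
    refine ⟨a₀, (lang_stdWord_append_a n).1.of_infix ⟨s, [], ?_⟩⟩
    simp [← hn]
  | cons c t => exact ⟨c, n, s, t, by simp [← hn]⟩

lemma Lang.image {w : List Letter} (h : Lang w) : Lang (subst w) := by
  obtain ⟨n, hn⟩ := h
  refine ⟨n + 2, (subst_infix hn).trans ?_⟩
  rw [stdWord_add_two_eq_subst]
  exact (List.prefix_append _ _).isInfix

lemma Lang.exists_infix_subst {w : List Letter} (h : Lang w) : ∃ u, Lang u ∧ w <:+: subst u := by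
  obtain ⟨n, hn⟩ := h
  refine ⟨stdWord n ++ [a₀], (lang_stdWord_append_a n).1, ?_⟩
  have h2 : stdWord n <:+: stdWord (n + 2) := (stdWord_suffix (by omega)).isInfix
  refine (hn.trans h2).trans ?_
  rw [stdWord_add_two_eq_subst]
  exact ⟨[], [a₁], by simp [substLetter]⟩

/-- All factors of length at most 14 occur in the standard word of index 11. A short factor that
straddles the middle letter of `stdWord (k + 2)` sees only the end of `stdWord k`, the letter
`hole k` and the beginning of `stdWord (k + 1)`, and these depend on `k` modulo 4 only. -/
lemma lang_short {w : List Letter} (hw : Lang w) (hl : w.length ≤ 14) : w <:+: stdWord 11 := by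
  obtain ⟨n, hn⟩ := hw
  induction n using Nat.strong_induction_on generalizing w with
  | _ n ih =>
    rcases Nat.lt_or_ge 11 n with h | h
    · obtain ⟨k, rfl⟩ : ∃ k, n = k + 2 := ⟨n - 2, by omega⟩
      have key : w <:+: stdWord k ∨ w <:+: stdWord (k + 1) ∨
          ∃ s p, w = s ++ p ∧ s <:+ stdWord k ∧ p <+: hole k :: stdWord (k + 1) := by
        rw [stdWord_add_two, List.infix_append_iff] at hn
        rcases hn with hn | hn | hn
        · exact .inl hn
        · rcases List.infix_cons_iff.1 hn with hn | hn
          · exact .inr (.inr ⟨[], w, rfl, List.nil_suffix, hn⟩)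
          · exact .inr (.inl hn)
        · exact .inr (.inr hn)
      rcases key with hn | hn | ⟨s, p, rfl, hs, hp⟩
      · exact ih k (by omega) hl hn
      · exact ih (k + 1) (by omega) hl hn
      · obtain ⟨k₀, j, h6, h9, rfl⟩ : ∃ k₀ j, 6 ≤ k₀ ∧ k₀ ≤ 9 ∧ k = k₀ + 4 * j :=
          ⟨6 + (k - 6) % 4, (k - 6) / 4, by omega, by omega, by omega⟩
        rw [List.length_append] at hl
        have hlen : 20 ≤ (stdWord k₀).length := (stdWord_suffix h6).length_le
        have hlen' : 20 ≤ (stdWord (k₀ + 1)).length :=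
          (stdWord_suffix (h6.trans (Nat.le_succ _))).length_le
        have hs' : s <:+ stdWord k₀ :=
          List.suffix_of_suffix_length_le hs (stdWord_suffix (by omega)) (by omega)
        have hp' : p <+: hole k₀ :: stdWord (k₀ + 1) := by
          refine List.prefix_of_prefix_length_le hp ?_ (by simp; omega)
          rw [hole_add_four_mul, List.prefix_cons_inj,
            show k₀ + 4 * j + 1 = k₀ + 1 + 2 * (2 * j) by ring]
          exact stdWord_prefix_add_two_mul _ _
        have : s ++ p <:+: stdWord (k₀ + 2) := by
          rw [stdWord_add_two]
          exact List.infix_append_iff.2 (.inr (.inr ⟨s, p, rfl, hs', hp'⟩))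
        exact this.trans (stdWord_suffix (by omega)).isInfix
    · exact hn.trans (stdWord_suffix h).isInfix

/-! ### Short factors -/

lemma Lang.of_prefix {v w : List Letter} (hw : Lang w) (h : v <+: w) : Lang v :=
  hw.of_infix h.isInfix

lemma Lang.cons_of_prefix {c : Letter} {v w : List Letter} (hw : Lang (c :: w)) (h : v <+: w) :
    Lang (c :: v) :=
  hw.of_prefix ((List.prefix_cons_inj c).2 h)

/-- The factors of length `n`, as an explicit list, provided `n ≤ 14`. -/
def shortFactors (n : ℕ) : List (List Letter) :=
  (((stdWord 11).tails.map (List.take n)).filter (fun w => w.length = n)).dedup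

lemma Lang.mem_shortFactors {w : List Letter} (hw : Lang w) (hl : w.length ≤ 14) :
    w ∈ shortFactors w.length := by
  obtain ⟨s, t, hst⟩ := lang_short hw hl
  simp only [shortFactors, List.mem_dedup, List.mem_filter, List.mem_map, decide_true, and_true,
    List.mem_tails]
  exact ⟨w ++ t, ⟨s, by rw [← hst, List.append_assoc]⟩, by simp⟩

set_option maxRecDepth 100000 in
lemma not_lang_cons_b_b (w : List Letter) : ¬ Lang (b :: b :: w) := fun h => by
  have h' := (h.of_prefix (v := [b, b]) ⟨w, rfl⟩).mem_shortFactors (by simp)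
  revert h'
  decide +kernel

set_option maxRecDepth 100000 in
lemma Lang.eq_b_of_append_a₁ {w : List Letter} {c : Letter} (h : Lang (w ++ [c] ++ [a₁])) :
    c = b := by
  have h' := (h.of_infix (v := [c, a₁]) ⟨w, [], by simp⟩).mem_shortFactors (by simp)
  revert h'
  cases c <;> decide +kernel

set_option maxRecDepth 100000 in
/-- A factor of length at least 3 is not followed both by `a₁` and by `b`. These are the letters
that the sequence of differences does not distinguish. -/
lemma not_lang_a₁_b {w : List Letter} (hl : 3 ≤ w.length) (h₁ : Lang (a₁ :: w))
    (h₂ : Lang (b :: w)) : False := by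
  have key : ∀ v ∈ shortFactors 4, a₁ :: v.tail ∈ shortFactors 4 →
      b :: v.tail ∉ shortFactors 4 := by
    decide +kernel
  have hlen : (w.take 3).length = 3 := by simp [hl]
  have h₁' := (h₁.cons_of_prefix (List.take_prefix 3 w)).mem_shortFactors (by simp)
  have h₂' := (h₂.cons_of_prefix (List.take_prefix 3 w)).mem_shortFactors (by simp)
  rw [List.length_cons, hlen] at h₁' h₂'
  exact key _ h₁' h₁' h₂'

set_option maxRecDepth 100000 in
/-- A factor of length at least 7 is not followed both by `a₀` and by `b`. -/
lemma not_lang_a₀_b {w : List Letter} (hl : 7 ≤ w.length) (h₁ : Lang (a₀ :: w))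
    (h₂ : Lang (b :: w)) : False := by
  have key : ∀ v ∈ shortFactors 8, a₀ :: v.tail ∈ shortFactors 8 →
      b :: v.tail ∉ shortFactors 8 := by
    decide +kernel
  have hlen : (w.take 7).length = 7 := by simp [hl]
  have h₁' := (h₁.cons_of_prefix (List.take_prefix 7 w)).mem_shortFactors (by simp)
  have h₂' := (h₂.cons_of_prefix (List.take_prefix 7 w)).mem_shortFactors (by simp)
  rw [List.length_cons, hlen] at h₁' h₂'
  exact key _ h₁' h₁' h₂'

/-! ### Right special factors and desubstitution -/

/-- `w` is a factor whose next difference is not determined: it can be followed by `a₀`, where the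
difference is `0`, and by one of `a₁` and `b`, where it is `1`. -/
def Special (w : List Letter) : Prop := Lang (a₀ :: w) ∧ (Lang (a₁ :: w) ∨ Lang (b :: w))

lemma Special.lang {w : List Letter} (h : Special w) : Lang w := h.1.of_cons

lemma Special.of_prefix {v w : List Letter} (hw : Special w) (h : v <+: w) : Special v :=
  ⟨hw.1.cons_of_prefix h, hw.2.imp (·.cons_of_prefix h) (·.cons_of_prefix h)⟩

lemma Special.image {v : List Letter} (h : Special v) : Special (subst v) := by
  have key : ∀ c : Letter, Lang (c :: v) →
      ∃ d : Letter, (substLetter c).getLast? = some d ∧ Lang (d :: subst v) := by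
    intro c hc
    have := hc.image
    cases c
    · exact ⟨a₁, rfl, this.of_infix ⟨[a₀, b], [], by simp [substLetter]⟩⟩
    · exact ⟨a₀, rfl, this.of_infix ⟨[a₀, b], [], by simp [substLetter]⟩⟩
    · exact ⟨a₀, rfl, this.of_infix ⟨[b], [], by simp [substLetter]⟩⟩
  have h₀ : Lang (a₁ :: subst v) := by simpa [substLetter] using key a₀ h.1
  refine ⟨?_, .inl h₀⟩
  rcases h.2 with h | h
  · simpa [substLetter] using key a₁ h
  · simpa [substLetter] using key b h

/-- A factor starting (in reading order) with `b` is preceded by `a₀` or `a₁`, and the images of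
these two letters both end with `b a₀`; hence the image of a special factor can be extended by these
two letters. -/
lemma Special.image_append {v : List Letter} (h : Special (v ++ [b])) :
    Special (subst (v ++ [b]) ++ [a₀, b]) := by
  have key : ∀ c : Letter, Lang (c :: (v ++ [b])) →
      ∃ d : Letter, d ≠ b ∧ Lang (c :: (v ++ [b]) ++ [d]) := by
    intro c hc
    obtain ⟨d, hd⟩ := hc.exists_append
    refine ⟨d, ?_, hd⟩
    rintro rfl
    exact not_lang_cons_b_b [] (hd.of_infix ⟨c :: v, [], by simp⟩)
  have key' : ∀ c : Letter, Lang (c :: (v ++ [b])) →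
      Lang ((if c = a₀ then a₁ else a₀) :: (subst (v ++ [b]) ++ [a₀, b])) := by
    intro c hc
    obtain ⟨d, hd, h⟩ := key c hc
    obtain ⟨e, he⟩ : ∃ e, substLetter d = [a₀, b, e] := by cases d <;> simp_all [substLetter]
    obtain ⟨s, hs⟩ : ∃ s, substLetter c = s ++ [if c = a₀ then a₁ else a₀] := by
      cases c
      exacts [⟨[a₀, b], rfl⟩, ⟨[a₀, b], rfl⟩, ⟨[b], rfl⟩]
    exact h.image.of_infix ⟨s, [e], by simp [hs, he]⟩
  refine ⟨?_, .inl (by simpa using key' a₀ h.1)⟩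
  rcases h.2 with h | h
  · simpa using key' a₁ h
  · simpa using key' b h

/-- The letter `a₁` occurs in images only as the first letter of the image of `a₀`. -/
lemma desubst_a₁ {u p q : List Letter} (h : subst u = q ++ a₁ :: p) :
    ∃ u₁ u₂, u = u₁ ++ a₀ :: u₂ ∧ p = subst u₂ := by
  induction u generalizing q with
  | nil => simp at h
  | cons c u ih =>
    rw [subst_cons] at h
    rcases List.append_eq_append_iff.1 h with ⟨t, ht, ht'⟩ | ⟨t, ht, ht'⟩
    · obtain ⟨u₁, u₂, rfl, hp⟩ := ih ht'
      exact ⟨c :: u₁, u₂, by simp, hp⟩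
    · cases t with
      | nil =>
        obtain ⟨u₁, u₂, rfl, hp⟩ := ih (q := []) (by simpa using ht'.symm)
        exact ⟨c :: u₁, u₂, by simp, hp⟩
      | cons d t =>
        obtain ⟨rfl, rfl⟩ : a₁ = d ∧ p = t ++ subst u := by simpa using ht'
        cases c <;> simp [substLetter] at ht
        · rcases q with _ | ⟨x, _ | ⟨y, _ | ⟨z, q⟩⟩⟩ <;> simp at ht
          obtain ⟨_, _, rfl⟩ := ht
          exact ⟨[], u, rfl, rfl⟩
        · rcases q with _ | ⟨x, _ | ⟨y, _ | ⟨z, q⟩⟩⟩ <;> simp at ht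
        · rcases q with _ | ⟨x, _ | ⟨y, q⟩⟩ <;> simp at ht

/-- The letter `a₀` in an image is the first letter of the image of `a₁` or `b`, or the last letter
of the image of `a₁` or `a₀`. -/
lemma desubst_a₀ {u p q : List Letter} (h : subst u = q ++ a₀ :: p) :
    ∃ u₁ c u₂, u = u₁ ++ c :: u₂ ∧ ((c ≠ a₀ ∧ p = subst u₂) ∨
      (c = a₁ ∧ p = b :: a₀ :: subst u₂) ∨ (c = a₀ ∧ p = b :: a₁ :: subst u₂)) := by
  induction u generalizing q with
  | nil => simp at h
  | cons c u ih =>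
    rw [subst_cons] at h
    rcases List.append_eq_append_iff.1 h with ⟨t, ht, ht'⟩ | ⟨t, ht, ht'⟩
    · obtain ⟨u₁, d, u₂, rfl, hp⟩ := ih ht'
      exact ⟨c :: u₁, d, u₂, by simp, hp⟩
    · cases t with
      | nil =>
        obtain ⟨u₁, d, u₂, rfl, hp⟩ := ih (q := []) (by simpa using ht'.symm)
        exact ⟨c :: u₁, d, u₂, by simp, hp⟩
      | cons d t =>
        obtain ⟨rfl, rfl⟩ : a₀ = d ∧ p = t ++ subst u := by simpa using ht'
        refine ⟨[], c, u, rfl, ?_⟩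
        cases c <;> simp [substLetter] at ht
        · rcases q with _ | ⟨x, _ | ⟨y, _ | ⟨z, q⟩⟩⟩ <;> simp at ht
          simp [← ht]
        · rcases q with _ | ⟨x, _ | ⟨y, _ | ⟨z, q⟩⟩⟩ <;> simp at ht
          · simp [← ht]
          · obtain ⟨rfl, rfl, rfl⟩ := ht
            simp
        · rcases q with _ | ⟨x, _ | ⟨y, q⟩⟩ <;> simp at ht
          obtain ⟨rfl, rfl⟩ := ht
          simp

/-- A common prefix of two images comes from a common prefix `v` of the words themselves. It can be
longer than the image of `v` only if `v` is followed by `a₀` in one word and by `a₁` in the other,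
and then by at most the two letters that the images of `a₀` and `a₁` have in common. -/
lemma exists_common_prefix {u u' w : List Letter} (h : w <+: subst u) (h' : w <+: subst u') :
    ∃ v, v <+: u ∧ v <+: u' ∧ (w <+: subst v ∨
      (w <+: subst v ++ [a₀, b] ∧ (v ++ [a₁] <+: u ∨ v ++ [a₁] <+: u'))) := by
  induction u generalizing u' w with
  | nil => exact ⟨[], List.nil_prefix, List.nil_prefix, .inl h⟩
  | cons c u ih =>
    cases u' with
    | nil => exact ⟨[], List.nil_prefix, List.nil_prefix, .inl h'⟩
    | cons c' u' =>
      rw [subst_cons] at h h'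
      by_cases hc : c = c'
      · subst hc
        rcases List.prefix_or_prefix_of_prefix h (List.prefix_append _ _) with hw | ⟨w, rfl⟩
        · exact ⟨[c], by simp, by simp, .inl (by simpa using hw)⟩
        · rw [List.prefix_append_right_inj] at h h'
          obtain ⟨v, hv, hv', hw⟩ := ih h h'
          refine ⟨c :: v, by simpa using hv, by simpa using hv', ?_⟩
          simpa [List.prefix_append_right_inj] using hw
      · refine ⟨[], List.nil_prefix, List.nil_prefix, ?_⟩
        rcases w with _ | ⟨x, _ | ⟨y, _ | ⟨z, w⟩⟩⟩ <;> cases c <;> cases c' <;>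
          simp_all [substLetter]

lemma length_subst_le (v : List Letter) : (subst v).length ≤ 3 * v.length := by
  induction v with
  | nil => simp
  | cons c v ih => cases c <;> simp [substLetter] <;> omega

/-- A special factor of length at least 11 is covered by the image of a special factor `v`, with the
two additional letters available only if `v` can be preceded, in reading order, by `a₁`. The bound
11 excludes the case that the last letter of `w` followed by `a₀` lies inside an image. -/
lemma Special.exists_desubst {w : List Letter} (h : Special w) (hl : 11 ≤ w.length) :
    ∃ v, Special v ∧ (w <+: subst v ∨
      (w <+: subst v ++ [a₀, b] ∧ Lang (v ++ [a₁]))) := by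
  have h₁ : Lang (a₁ :: w) := h.2.resolve_right fun hb => not_lang_a₀_b (by omega) h.1 hb
  obtain ⟨U, hU, q, r, hUq⟩ := h₁.exists_infix_subst
  obtain ⟨q₁, u, rfl, hu⟩ := desubst_a₁ (u := U) (p := w ++ r) (q := q) (by simp [← hUq])
  have hu₀ : Lang (a₀ :: u) := hU.of_infix ⟨q₁, [], by simp⟩
  have hwu : w <+: subst u := ⟨r, hu⟩
  obtain ⟨U', hU', q', r', hUq'⟩ := h.1.exists_infix_subst
  obtain ⟨q₁', c, u', rfl, hu'⟩ :=
    desubst_a₀ (u := U') (p := w ++ r') (q := q') (by simp [← hUq'])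
  have hcu' : Lang (c :: u') := hU'.of_infix ⟨q₁', [], by simp⟩
  rcases hu' with ⟨hc, hp⟩ | ⟨rfl, hp⟩ | ⟨rfl, hp⟩
  -- `a₀` begins an image, as does `a₁`: both occurrences of `w` are cut at the same place.
  · obtain ⟨v, hv, hv', hw⟩ := exists_common_prefix hwu ⟨r', hp⟩
    refine ⟨v, ⟨hu₀.cons_of_prefix hv, ?_⟩, ?_⟩
    · have := hcu'.cons_of_prefix hv'
      cases c <;> simp_all
    · refine hw.imp_right fun ⟨hw, ha⟩ => ⟨hw, ?_⟩
      exact ha.elim hu₀.of_cons.of_prefix hcu'.of_cons.of_prefix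
  -- `a₀` ends the image of `a₁`: then a common prefix of `u` and `u'` can be followed by `a₁` and
  -- by `b`, so that it has length at most 2 and `w` has length at most 10.
  · rcases w with _ | ⟨x, _ | ⟨y, w⟩⟩
    · simp at hl
    · simp at hl
    obtain ⟨rfl, rfl, hp'⟩ : x = b ∧ y = a₀ ∧ w ++ r' = subst u' := by simpa using hp
    rcases u with _ | ⟨d, u⟩
    · simp at hwu
    obtain rfl : d = b := by
      cases d <;> simp [substLetter] at hwu ⊢
    have hwu' : w <+: subst u := by simpa [substLetter] using hwu
    obtain ⟨v, hv, hv', hw⟩ := exists_common_prefix hwu' ⟨r', hp'⟩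
    have hlen := length_subst_le v
    have hwlen : w.length ≤ (subst v).length + 2 := by
      rcases hw with hw | ⟨hw, -⟩
      · exact hw.length_le.trans (by omega)
      · simpa using hw.length_le
    simp only [List.length_cons] at hl
    exact (not_lang_a₁_b (w := v) (by omega) (hcu'.cons_of_prefix hv')
      (hu₀.of_cons.cons_of_prefix hv)).elim
  -- `a₀` ends the image of `a₀`: then `w` ends with `a₁ b`, and cannot be followed by `a₁`.
  · rcases w with _ | ⟨x, _ | ⟨y, w⟩⟩
    · simp at hl
    · simp at hl
    obtain ⟨rfl, rfl, hp'⟩ : x = b ∧ y = a₁ ∧ w ++ r' = subst u' := by simpa using hp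
    rcases u with _ | ⟨d, u⟩
    · simp at hwu
    cases d <;> simp [substLetter] at hwu

/-! ### Trunks and twigs -/

/-- The special factors of length `F (2 * k + 7)`. For `k = 0` they are those of length 13. -/
def trunk (i : Fin 3) : ℕ → List Letter
  | 0 => ![[b, a₀, a₀, b, a₁, a₀, b, a₁, b, a₀, a₀, b, a₀],
      [a₀, b, a₁, b, a₀, a₀, b, a₁, a₀, b, a₁, b, a₀],
      [a₀, b, a₁, b, a₀, a₀, b, a₀, b, a₀, a₀, b, a₁]] i
  | k + 1 => subst (trunk i k)

/-- A special factor of length `F (2 * k + 5) + F (2 * k + 2)` that has no special extension. -/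
def oddTwig : ℕ → List Letter
  | 0 => [a₀, b, a₀, a₀, b, a₁]
  | k + 1 => subst (oddTwig k)

/-- A special factor of length `F (2 * k + 6) + F (2 * k + 3) - 1` that has no special extension. As
it starts with `b` in reading order, its image extends by two letters. -/
def evenTwig : ℕ → List Letter
  | 0 => [b, a₀, a₀, b, a₁, b, a₀, a₀, b]
  | k + 1 => subst (evenTwig k) ++ [a₀, b]

set_option maxRecDepth 100000 in
lemma special_trunk (i : Fin 3) (k : ℕ) : Special (trunk i k) := by
  induction k with
  | zero =>
    have : ∀ i, a₀ :: trunk i 0 <:+: stdWord 11 ∧ a₁ :: trunk i 0 <:+: stdWord 11 := by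
      decide +kernel
    exact ⟨⟨11, (this i).1⟩, .inl ⟨11, (this i).2⟩⟩
  | succ k ih => exact ih.image

set_option maxRecDepth 100000 in
lemma special_oddTwig (k : ℕ) : Special (oddTwig k) := by
  induction k with
  | zero => exact ⟨⟨11, by decide +kernel⟩, .inr ⟨11, by decide +kernel⟩⟩
  | succ k ih => exact ih.image

lemma exists_evenTwig_eq (k : ℕ) : ∃ v, evenTwig k = v ++ [b] := by
  cases k with
  | zero => exact ⟨[b, a₀, a₀, b, a₁, b, a₀, a₀], rfl⟩
  | succ k => exact ⟨subst (evenTwig k) ++ [a₀], by simp [evenTwig]⟩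

set_option maxRecDepth 100000 in
lemma special_evenTwig (k : ℕ) : Special (evenTwig k) := by
  induction k with
  | zero => exact ⟨⟨11, by decide +kernel⟩, .inl ⟨11, by decide +kernel⟩⟩
  | succ k ih =>
    obtain ⟨v, hv⟩ := exists_evenTwig_eq k
    rw [hv] at ih
    rw [evenTwig, hv]
    exact ih.image_append

lemma exists_oddTwig_eq (k : ℕ) : ∃ v c, c ≠ b ∧ oddTwig k = v ++ [c] := by
  induction k with
  | zero => exact ⟨[a₀, b, a₀, a₀, b], a₁, by decide, rfl⟩
  | succ k ih =>
    obtain ⟨v, c, hc, hv⟩ := ih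
    rw [oddTwig, hv]
    cases c
    · exact ⟨subst v ++ [a₀, b], a₁, by decide, by simp [substLetter]⟩
    · exact ⟨subst v ++ [a₀, b], a₀, by decide, by simp [substLetter]⟩
    · exact absurd rfl hc

/-! ### Lengths of trunks and twigs -/

/-- The number of letters `a₀` and `a₁` in `w`. -/
def numA (w : List Letter) : ℕ := w.countP (· ≠ b)

/-- The number of letters `b` in `w`. -/
def numB (w : List Letter) : ℕ := w.countP (· = b)

lemma numA_add_numB (w : List Letter) : numA w + numB w = w.length := by
  simpa [numA, numB, add_comm] using (List.length_eq_countP_add_countP (· = b) (l := w)).symm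

@[simp] lemma numA_append (v w : List Letter) : numA (v ++ w) = numA v + numA w :=
  List.countP_append

@[simp] lemma numB_append (v w : List Letter) : numB (v ++ w) = numB v + numB w :=
  List.countP_append

@[simp] lemma numA_subst (w : List Letter) : numA (subst w) = 2 * numA w + numB w := by
  induction w with
  | nil => rfl
  | cons c w ih =>
    rw [subst_cons, numA_append, ih, ← List.singleton_append (l := w), numA_append, numB_append]
    cases c <;> simp [substLetter, numA, numB] <;> ring

@[simp] lemma numB_subst (w : List Letter) : numB (subst w) = numA w + numB w := by
  induction w with
  | nil => rfl
  | cons c w ih =>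
    rw [subst_cons, numB_append, ih, ← List.singleton_append (l := w), numA_append, numB_append]
    cases c <;> simp [substLetter, numA, numB] <;> ring

lemma fib_add_three (n : ℕ) : Nat.fib (n + 3) = 2 * Nat.fib (n + 1) + Nat.fib n := by
  have h₁ := Nat.fib_add_two (n := n)
  have h₂ := Nat.fib_add_two (n := n + 1)
  simp only [add_assoc, Nat.reduceAdd] at *
  omega

lemma trunk_counts (i : Fin 3) (k : ℕ) :
    numA (trunk i k) = Nat.fib (2 * k + 6) ∧ numB (trunk i k) = Nat.fib (2 * k + 5) := by
  induction k with
  | zero => revert i; decide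
  | succ k ih =>
    have h₁ := fib_add_three (2 * k + 5)
    have h₂ := Nat.fib_add_two (n := 2 * k + 5)
    simp only [trunk, numA_subst, numB_subst, mul_add, add_assoc, Nat.reduceAdd, Nat.reduceMul] at *
    omega

lemma length_trunk (i : Fin 3) (k : ℕ) : (trunk i k).length = Nat.fib (2 * k + 7) := by
  rw [← numA_add_numB, (trunk_counts i k).1, (trunk_counts i k).2,
    Nat.fib_add_two (n := 2 * k + 5), add_comm]

lemma oddTwig_counts (k : ℕ) :
    numA (oddTwig k) = Nat.fib (2 * k + 4) + Nat.fib (2 * k + 1) ∧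
      numB (oddTwig k) = Nat.fib (2 * k + 3) + Nat.fib (2 * k) := by
  induction k with
  | zero => decide
  | succ k ih =>
    have h₁ := fib_add_three (2 * k + 3)
    have h₂ := Nat.fib_add_two (n := 2 * k + 3)
    have h₃ := fib_add_three (2 * k)
    have h₄ := Nat.fib_add_two (n := 2 * k)
    simp only [oddTwig, numA_subst, numB_subst, mul_add, add_assoc,
      Nat.reduceAdd, Nat.reduceMul] at *
    omega

lemma length_oddTwig (k : ℕ) :
    (oddTwig k).length = Nat.fib (2 * k + 5) + Nat.fib (2 * k + 2) := by
  have h₁ := Nat.fib_add_two (n := 2 * k + 3)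
  have h₂ := Nat.fib_add_two (n := 2 * k)
  have h₃ := oddTwig_counts k
  rw [← numA_add_numB]
  simp only [add_assoc, Nat.reduceAdd] at *
  omega

lemma evenTwig_counts (k : ℕ) :
    numA (evenTwig k) + 1 = Nat.fib (2 * k + 5) + Nat.fib (2 * k + 2) ∧
      numB (evenTwig k) = Nat.fib (2 * k + 4) + Nat.fib (2 * k + 1) := by
  induction k with
  | zero => decide
  | succ k ih =>
    have h₁ := fib_add_three (2 * k + 4)
    have h₂ := Nat.fib_add_two (n := 2 * k + 4)
    have h₃ := fib_add_three (2 * k + 1)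
    have h₄ := Nat.fib_add_two (n := 2 * k + 1)
    have h₅ : numA [a₀, b] = 1 := rfl
    have h₆ : numB [a₀, b] = 1 := rfl
    simp only [evenTwig, numA_append, numB_append, numA_subst, numB_subst, mul_add, add_assoc,
      Nat.reduceAdd, Nat.reduceMul] at *
    omega

lemma length_evenTwig (k : ℕ) :
    (evenTwig k).length + 1 = Nat.fib (2 * k + 6) + Nat.fib (2 * k + 3) := by
  have h₁ := Nat.fib_add_two (n := 2 * k + 4)
  have h₂ := Nat.fib_add_two (n := 2 * k + 1)
  have h₃ := evenTwig_counts k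
  rw [← numA_add_numB]
  simp only [add_assoc, Nat.reduceAdd] at *
  omega

/-! ### Classification of the right special factors -/

set_option maxRecDepth 100000 in
lemma Special.prefix_of_length_le {w : List Letter} (hw : Special w) (hl : w.length ≤ 13) :
    (∃ i, w <+: trunk i 0) ∨ w <+: oddTwig 0 ∨ w <+: evenTwig 0 := by
  have key : ∀ n < 14, ∀ v ∈ shortFactors (n + 1), a₀ :: v.tail ∈ shortFactors (n + 1) →
      v.head? ≠ some a₀ → (∃ i, v.tail <+: trunk i 0) ∨ v.tail <+: oddTwig 0 ∨
        v.tail <+: evenTwig 0 := by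
    decide +kernel
  have h₀ := hw.1.mem_shortFactors (by simp; omega)
  rcases hw.2 with h | h <;>
  exact key w.length (by omega) _ (h.mem_shortFactors (by simp; omega)) h₀ (by simp)

lemma length_oddTwig_lt (k : ℕ) : (oddTwig k).length < Nat.fib (2 * k + 7) := by
  have h₁ := Nat.fib_add_two (n := 2 * k + 5)
  have h₂ := Nat.fib_add_two (n := 2 * k + 4)
  have h₃ : Nat.fib (2 * k + 2) ≤ Nat.fib (2 * k + 4) := Nat.fib_mono (by omega)
  have h₄ : 0 < Nat.fib (2 * k + 5) := Nat.fib_pos.2 (by omega)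
  rw [length_oddTwig]
  simp only [add_assoc, Nat.reduceAdd] at *
  omega

lemma length_evenTwig_lt (k : ℕ) : (evenTwig k).length < Nat.fib (2 * k + 7) := by
  have h₁ := Nat.fib_add_two (n := 2 * k + 5)
  have h₂ : Nat.fib (2 * k + 3) ≤ Nat.fib (2 * k + 5) := Nat.fib_mono (by omega)
  have h₃ := length_evenTwig k
  simp only [add_assoc, Nat.reduceAdd] at *
  omega

/-- The second trunk is continued not by a trunk but by a twig of the next generation. -/
lemma trunk_prefix_succ (i : Fin 3) (k : ℕ) :
    (∃ i', trunk i k <+: trunk i' (k + 1)) ∨ trunk i k <+: oddTwig (k + 1) := by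
  induction k with
  | zero => revert i; decide
  | succ k ih => exact ih.imp (fun ⟨i', h⟩ => ⟨i', subst_prefix h⟩) subst_prefix

/-- The two additional letters of `Special.exists_desubst` cause no harm for a proper prefix `v` of
a factor `u`: the letter of `u` after `v` cannot be `b`, and the images of `a₀` and `a₁` start with
these letters. -/
lemma subst_append_prefix {v u : List Letter} (h : v <+: u) (hv : v ≠ []) (hvu : v ≠ u)
    (hu : Lang u) (ha : Lang (v ++ [a₁])) : subst v ++ [a₀, b] <+: subst u := by
  obtain ⟨t, rfl⟩ := h
  obtain ⟨c, t, rfl⟩ := List.exists_cons_of_ne_nil (l := t) (by rintro rfl; simp at hvu)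
  obtain ⟨v, d, rfl⟩ := List.eq_nil_or_concat v |>.resolve_left hv
  simp only [List.concat_eq_append] at *
  obtain rfl := ha.eq_b_of_append_a₁
  obtain ⟨e, he⟩ : ∃ e, substLetter c = [a₀, b, e] := by
    cases c
    · exact ⟨_, rfl⟩
    · exact ⟨_, rfl⟩
    · exact (not_lang_cons_b_b [] (hu.of_infix ⟨v, t, by simp⟩)).elim
  exact ⟨e :: subst t, by simp [he]⟩

/-- A special factor of length at most `F (2 * k + 7)` is a suffix of a trunk of generation `k` or
of a twig of a generation up to `k`. -/
theorem Special.classification (k : ℕ) {w : List Letter} (hw : Special w)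
    (hl : w.length ≤ Nat.fib (2 * k + 7)) :
    (∃ i, w <+: trunk i k) ∨ ∃ j ≤ k, w <+: oddTwig j ∨ w <+: evenTwig j := by
  induction k generalizing w with
  | zero =>
    rcases hw.prefix_of_length_le hl with h | h
    exacts [.inl h, .inr ⟨0, le_rfl, h⟩]
  | succ k ih =>
    rcases Nat.lt_or_ge w.length 11 with h11 | h11
    · have : Nat.fib 7 ≤ Nat.fib (2 * k + 7) := Nat.fib_mono (by omega)
      have : Nat.fib 7 = 13 := rfl
      rcases ih hw (by omega) with ⟨i, hi⟩ | ⟨j, hj, h⟩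
      · rcases trunk_prefix_succ i k with ⟨i', h⟩ | h
        · exact .inl ⟨i', hi.trans h⟩
        · exact .inr ⟨k + 1, le_rfl, .inl (hi.trans h)⟩
      · exact .inr ⟨j, by omega, h⟩
    obtain ⟨v, hv, hwv⟩ := hw.exists_desubst h11
    rcases Nat.le_total (Nat.fib (2 * k + 7)) v.length with hvl | hvl
    -- If `v` is too long for the induction hypothesis, then its part of length `F (2 * k + 7)` is a
    -- trunk, whose image is already long enough to cover `w`.
    · have htake : (v.take (Nat.fib (2 * k + 7))).length = Nat.fib (2 * k + 7) := by simp [hvl]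
      have hw' : w <+: subst v ++ [a₀, b] :=
        hwv.elim (fun h => h.trans (List.prefix_append _ _)) (·.1)
      have hpre := List.take_prefix (Nat.fib (2 * k + 7)) v
      have htrunk : ∀ i, v.take (Nat.fib (2 * k + 7)) <+: trunk i k → w <+: trunk i (k + 1) := by
        intro i hi
        have heq := hi.eq_of_length (by rw [htake, length_trunk])
        rw [heq] at hpre
        refine List.prefix_of_prefix_length_le hw'
          ((subst_prefix hpre).trans (List.prefix_append _ _)) ?_
        exact hl.trans_eq (length_trunk i (k + 1)).symm
      rcases ih (hv.of_prefix hpre) htake.le with ⟨i, hi⟩ | ⟨j, hj, h⟩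
      · exact .inl ⟨i, htrunk i hi⟩
      · have hjk : Nat.fib (2 * j + 7) ≤ Nat.fib (2 * k + 7) := Nat.fib_mono (by omega)
        have := length_oddTwig_lt j
        have := length_evenTwig_lt j
        rcases h with h | h <;> have := h.length_le <;> omega
    · have hne : v ≠ [] := by
        rintro rfl
        have : w.length ≤ 2 := by
          rcases hwv with h | ⟨h, -⟩
          · simpa using h.length_le.trans (Nat.zero_le 2)
          · simpa using h.length_le
        omega
      have key : ∀ u, Lang u → v <+: u → v ≠ u → w <+: subst u := fun u hu hvu hne' =>
        hwv.elim (fun h => h.trans (subst_prefix hvu))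
          fun h => h.1.trans (subst_append_prefix hvu hne hne' hu h.2)
      rcases ih hv hvl with ⟨i, hi⟩ | ⟨j, hj, h | h⟩
      · refine .inl ⟨i, ?_⟩
        by_cases hvi : v = trunk i k
        · refine List.prefix_of_prefix_length_le (l₃ := subst v ++ [a₀, b])
            (hwv.elim (fun h => h.trans (List.prefix_append _ _)) (·.1)) ?_
            (hl.trans_eq (length_trunk i (k + 1)).symm)
          rw [hvi]
          exact List.prefix_append _ _
        · exact key _ (special_trunk i k).lang hi hvi
      · refine .inr ⟨j + 1, by omega, .inl ?_⟩
        by_cases hvj : v = oddTwig j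
        · obtain ⟨v', c, hc, hv'⟩ := exists_oddTwig_eq j
          rcases hwv with h | ⟨-, h⟩
          · rwa [hvj] at h
          · rw [hvj, hv'] at h
            exact (hc h.eq_b_of_append_a₁).elim
        · exact key _ (special_oddTwig j).lang h hvj
      · refine .inr ⟨j + 1, by omega, .inr ?_⟩
        by_cases hvj : v = evenTwig j
        · rw [evenTwig, ← hvj]
          exact hwv.elim (fun h => h.trans (List.prefix_append _ _)) (·.1)
        · exact (key _ (special_evenTwig j).lang h hvj).trans (List.prefix_append _ _)

/-! ### The number of right special factors of a given length -/

/-- The longest common prefix of `u` and `v` has length `n`, and is a proper prefix of both. -/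
def SplitAt (n : ℕ) (u v : List Letter) : Prop :=
  ∃ c d e, c.length = n ∧ d ≠ e ∧ c ++ [d] <+: u ∧ c ++ [e] <+: v

lemma SplitAt.take_ne {n N : ℕ} {u v : List Letter} (h : SplitAt n u v) (hN : n < N) :
    u.take N ≠ v.take N := by
  obtain ⟨c, d, e, rfl, hde, ⟨s, rfl⟩, ⟨t, rfl⟩⟩ := h
  intro heq
  have := congrArg (fun w => w[c.length]?) heq
  simp [hN] at this
  exact hde this

lemma SplitAt.take_eq {n N : ℕ} {u v : List Letter} (h : SplitAt n u v) (hN : N ≤ n) :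
    u.take N = v.take N := by
  obtain ⟨c, d, e, rfl, hde, ⟨s, rfl⟩, ⟨t, rfl⟩⟩ := h
  simp [List.take_append_of_le_length hN]

lemma splitAt_zero {u v : List Letter} (hu : [b] <+: u) (hv : [a₀] <+: v) : SplitAt 0 u v :=
  ⟨[], b, a₀, rfl, by decide, hu, hv⟩

lemma b_prefix_subst {u : List Letter} (hu : [b] <+: u) : [b] <+: subst u :=
  (List.prefix_append [b] [a₀]).trans (subst_prefix hu)

lemma a₀_prefix_subst {u : List Letter} (hu : [a₀] <+: u) : [a₀] <+: subst u :=
  (List.prefix_append [a₀] [b, a₁]).trans (subst_prefix hu)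

lemma b_prefix_trunk (k : ℕ) : [b] <+: trunk 0 k := by
  induction k with
  | zero => decide
  | succ k ih => exact b_prefix_subst ih

lemma a₀_prefix_trunk (k : ℕ) : [a₀] <+: trunk 1 k ∧ [a₀] <+: trunk 2 k := by
  induction k with
  | zero => decide
  | succ k ih => exact ⟨a₀_prefix_subst ih.1, a₀_prefix_subst ih.2⟩

lemma a₀_prefix_oddTwig (k : ℕ) : [a₀] <+: oddTwig k := by
  induction k with
  | zero => decide
  | succ k ih => exact a₀_prefix_subst ih

lemma b_prefix_evenTwig (k : ℕ) : [b] <+: evenTwig k := by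
  induction k with
  | zero => decide
  | succ k ih => exact (b_prefix_subst ih).trans (List.prefix_append _ _)

/-- The first trunk and the even twig separate at letters exactly one of which is `b`. This persists
under the substitution, the longest common prefix being replaced by its image. -/
lemma exists_block_split (k : ℕ) : ∃ c d e, numA c = Nat.fib (2 * k + 4) ∧
    numB c = Nat.fib (2 * k + 3) ∧ (d = b ∧ e ≠ b ∨ d ≠ b ∧ e = b) ∧ c ++ [d] <+: trunk 0 k ∧
      c ++ [e] <+: evenTwig k := by
  induction k with
  | zero => exact ⟨[b, a₀, a₀, b, a₁], a₀, b, by decide⟩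
  | succ k ih =>
    obtain ⟨c, d, e, hA, hB, hde, hd, he⟩ := ih
    have h₁ := fib_add_three (2 * k + 3)
    have h₂ := Nat.fib_add_two (n := 2 * k + 3)
    have hhead : ∀ d, ∃ d' t, substLetter d = d' :: t ∧ (d = b ↔ d' = b) := by
      intro d; cases d <;> simp [substLetter]
    obtain ⟨d', s, hs, hd'⟩ := hhead d
    obtain ⟨e', t, ht, he'⟩ := hhead e
    refine ⟨subst c, d', e', ?_, ?_, ?_, ?_, ?_⟩
    · simp only [numA_subst, mul_add, add_assoc, Nat.reduceAdd, Nat.reduceMul] at *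
      omega
    · simp only [numB_subst, mul_add, add_assoc, Nat.reduceAdd, Nat.reduceMul] at *
      omega
    · simpa only [ne_eq, hd', he'] using hde
    · exact List.IsPrefix.trans ⟨s, by simp [hs]⟩ (subst_prefix hd)
    · exact (List.IsPrefix.trans ⟨t, by simp [ht]⟩ (subst_prefix he)).trans
        (List.prefix_append _ _)

lemma splitAt_trunk_evenTwig (k : ℕ) : SplitAt (Nat.fib (2 * k + 5)) (trunk 0 k) (evenTwig k) := by
  obtain ⟨c, d, e, hA, hB, hde, hd, he⟩ := exists_block_split k
  refine ⟨c, d, e, ?_, by rintro rfl; tauto, hd, he⟩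
  rw [← numA_add_numB, hA, hB, Nat.fib_add_two (n := 2 * k + 3), add_comm]

/-- `u` and `v` separate at the letters `a₀` and `a₁`, in either order, after a longest common
prefix with `p - 1` letters `a₀`, `a₁` and `q` letters `b`. The offset makes the effect of the
substitution on `(p, q)` linear, see `HoleSplit.subst`. -/
def HoleSplit (p q : ℕ) (u v : List Letter) : Prop :=
  ∃ c d e, numA c + 1 = p ∧ numB c = q ∧ d ≠ b ∧ e ≠ b ∧ d ≠ e ∧ c ++ [d] <+: u ∧ c ++ [e] <+: v

lemma HoleSplit.subst {p q : ℕ} {u v : List Letter} (h : HoleSplit p q u v) :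
    HoleSplit (2 * p + q) (p + q) (subst u) (subst v) := by
  obtain ⟨c, d, e, hA, hB, hd, he, hde, hu, hv⟩ := h
  have key : ∀ d, d ≠ b → ∃ d', substLetter d = [a₀, b, d'] ∧ d' ≠ b ∧ (d' = a₀ ↔ d = a₁) := by
    intro d; cases d <;> simp [substLetter]
  obtain ⟨d', hd', hd'b, hd₁⟩ := key d hd
  obtain ⟨e', he', he'b, he₁⟩ := key e he
  have h₁ : numA [a₀, b] = 1 := rfl
  have h₂ : numB [a₀, b] = 1 := rfl
  refine ⟨FibThueMorse.subst c ++ [a₀, b], d', e', ?_, ?_, hd'b, he'b, ?_, ?_, ?_⟩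
  · simp only [numA_append, numA_subst]
    omega
  · simp only [numB_append, numB_subst]
    omega
  · rintro rfl
    cases d <;> cases e <;> simp_all
  · simpa [hd'] using subst_prefix hu
  · simpa [he'] using subst_prefix hv

lemma HoleSplit.splitAt {p q n : ℕ} {u v : List Letter} (h : HoleSplit p q u v)
    (hn : n + 1 = p + q) : SplitAt n u v := by
  obtain ⟨c, d, e, hA, hB, -, -, hde, hu, hv⟩ := h
  refine ⟨c, d, e, ?_, hde, hu, hv⟩
  rw [← numA_add_numB]
  omega

lemma holeSplit_trunk (k : ℕ) :
    HoleSplit (Nat.fib (2 * k + 5)) (Nat.fib (2 * k + 4)) (trunk 1 k) (trunk 2 k) := by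
  induction k with
  | zero => exact ⟨[a₀, b, a₁, b, a₀, a₀, b], a₁, a₀, by decide⟩
  | succ k ih =>
    have h := ih.subst
    rwa [← fib_add_three, add_comm (Nat.fib _), ← Nat.fib_add_two] at h

lemma holeSplit_oddTwig (i : Fin 3) (hi : i ≠ 0) (k : ℕ) :
    HoleSplit (Nat.fib (2 * k + 3)) (Nat.fib (2 * k + 2)) (trunk i k) (oddTwig k) := by
  induction k with
  | zero =>
    refine ⟨[a₀, b], a₁, a₀, ?_⟩
    revert i
    decide
  | succ k ih =>
    have h := ih.subst
    rwa [← fib_add_three, add_comm (Nat.fib _), ← Nat.fib_add_two] at h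

lemma splitAt_trunk (k : ℕ) : SplitAt (Nat.fib (2 * k + 6) - 1) (trunk 1 k) (trunk 2 k) := by
  refine (holeSplit_trunk k).splitAt ?_
  have h₁ := Nat.fib_add_two (n := 2 * k + 4)
  have h₂ : 0 < Nat.fib (2 * k + 6) := Nat.fib_pos.2 (by omega)
  simp only [add_assoc, Nat.reduceAdd] at *
  omega

lemma splitAt_trunk_oddTwig (i : Fin 3) (hi : i ≠ 0) (k : ℕ) :
    SplitAt (Nat.fib (2 * k + 4) - 1) (trunk i k) (oddTwig k) := by
  refine (holeSplit_oddTwig i hi k).splitAt ?_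
  have h₁ := Nat.fib_add_two (n := 2 * k + 2)
  have h₂ : 0 < Nat.fib (2 * k + 4) := Nat.fib_pos.2 (by omega)
  simp only [add_assoc, Nat.reduceAdd] at *
  omega

/-- In the given range of lengths, the twigs of earlier generations are too short to contribute. -/
lemma special_length_iff {k N : ℕ} (hN : Nat.fib (2 * k + 5) < N) (hN' : N ≤ Nat.fib (2 * k + 7))
    (w : List Letter) :
    (Special w ∧ w.length = N) ↔ (w = (trunk 0 k).take N ∨ w = (trunk 1 k).take N ∨
      w = (trunk 2 k).take N) ∨ (N ≤ (oddTwig k).length ∧ w = (oddTwig k).take N) ∨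
      (N ≤ (evenTwig k).length ∧ w = (evenTwig k).take N) := by
  have htake : ∀ u : List Letter, Special u → N ≤ u.length →
      Special (u.take N) ∧ (u.take N).length = N := fun u hu hl =>
    ⟨hu.of_prefix (List.take_prefix _ _), by simpa using hl⟩
  constructor
  · rintro ⟨hw, rfl⟩
    rcases hw.classification k hN' with ⟨i, hi⟩ | ⟨j, hj, h⟩
    · left
      have := List.prefix_iff_eq_take.1 hi
      fin_cases i
      exacts [.inl this, .inr (.inl this), .inr (.inr this)]
    · right
      obtain rfl : j = k := by
        by_contra hjk
        have : Nat.fib (2 * j + 7) ≤ Nat.fib (2 * k + 5) := Nat.fib_mono (by omega)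
        have := length_oddTwig_lt j
        have := length_evenTwig_lt j
        rcases h with h | h <;> have := h.length_le <;> omega
      exact h.imp (fun h => ⟨h.length_le, List.prefix_iff_eq_take.1 h⟩)
        fun h => ⟨h.length_le, List.prefix_iff_eq_take.1 h⟩
  · have htr : ∀ i, Special ((trunk i k).take N) ∧ ((trunk i k).take N).length = N := fun i =>
      htake _ (special_trunk i k) (hN'.trans_eq (length_trunk i k).symm)
    rintro ((rfl | rfl | rfl) | ⟨h, rfl⟩ | ⟨h, rfl⟩)
    · exact htr 0
    · exact htr 1
    · exact htr 2
    · exact htake _ (special_oddTwig k) h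
    · exact htake _ (special_evenTwig k) h

lemma ncard_special {k N : ℕ} (hN : Nat.fib (2 * k + 5) < N) (hN' : N ≤ Nat.fib (2 * k + 7)) :
    (N ≤ Nat.fib (2 * k + 5) + Nat.fib (2 * k + 2) →
      {w | Special w ∧ w.length = N}.ncard = 4) ∧
    (Nat.fib (2 * k + 5) + Nat.fib (2 * k + 2) < N → N < Nat.fib (2 * k + 6) →
      {w | Special w ∧ w.length = N}.ncard = 3) ∧
    (Nat.fib (2 * k + 6) ≤ N → N < Nat.fib (2 * k + 6) + Nat.fib (2 * k + 3) →
      {w | Special w ∧ w.length = N}.ncard = 4) ∧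
    (Nat.fib (2 * k + 6) + Nat.fib (2 * k + 3) ≤ N →
      {w | Special w ∧ w.length = N}.ncard = 3) := by
  have hpos : 0 < N := by omega
  have f₄ : Nat.fib (2 * k + 4) ≤ Nat.fib (2 * k + 5) := Nat.fib_mono (by omega)
  have f₂ : Nat.fib (2 * k + 2) < Nat.fib (2 * k + 4) :=
    (Nat.fib_lt_fib (by omega)).2 (by omega)
  have f₆ : Nat.fib (2 * k + 6) = Nat.fib (2 * k + 4) + Nat.fib (2 * k + 5) := Nat.fib_add_two
  have h01 := (splitAt_zero (b_prefix_trunk k) (a₀_prefix_trunk k).1).take_ne hpos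
  have h02 := (splitAt_zero (b_prefix_trunk k) (a₀_prefix_trunk k).2).take_ne hpos
  have h0o := (splitAt_zero (b_prefix_trunk k) (a₀_prefix_oddTwig k)).take_ne hpos
  have he1 := ((splitAt_zero (b_prefix_evenTwig k) (a₀_prefix_trunk k).1).take_ne hpos).symm
  have he2 := ((splitAt_zero (b_prefix_evenTwig k) (a₀_prefix_trunk k).2).take_ne hpos).symm
  have heo := ((splitAt_zero (b_prefix_evenTwig k) (a₀_prefix_oddTwig k)).take_ne hpos).symm
  have h0e := (splitAt_trunk_evenTwig k).take_ne hN
  have h1o := (splitAt_trunk_oddTwig 1 (by decide) k).take_ne (N := N) (by omega)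
  have h12 : Nat.fib (2 * k + 6) ≤ N → (trunk 1 k).take N ≠ (trunk 2 k).take N := fun h =>
    (splitAt_trunk k).take_ne (by have := Nat.fib_pos.2 (show 0 < 2 * k + 6 by omega); omega)
  have h12' : N < Nat.fib (2 * k + 6) → (trunk 1 k).take N = (trunk 2 k).take N := fun h =>
    (splitAt_trunk k).take_eq (by omega)
  have hiff := special_length_iff hN hN'
  have ho := length_oddTwig k
  have he := length_evenTwig k
  simp only [hiff]
  have card₃ : ∀ x y z : List Letter, x ≠ y → x ≠ z → y ≠ z →
      ({x, y, z} : Set (List Letter)).ncard = 3 := by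
    intro x y z h₁ h₂ h₃
    rw [Set.ncard_eq_three]
    exact ⟨x, y, z, h₁, h₂, h₃, rfl⟩
  have card₄ : ∀ x y z t : List Letter, x ≠ y → x ≠ z → x ≠ t → y ≠ z → y ≠ t → z ≠ t →
      ({x, y, z, t} : Set (List Letter)).ncard = 4 := by
    intro x y z t h₁ h₂ h₃ h₄ h₅ h₆
    rw [Set.ncard_insert_of_notMem (by simp [*]) (by simp), card₃ y z t h₄ h₅ h₆]
  refine ⟨fun h => ?_, fun h h' => ?_, fun h h' => ?_, fun h => ?_⟩
  · refine (congrArg Set.ncard (Set.ext fun w => ?_)).trans (card₄ _ _ _ _ h01 h0o h0e h1o he1 heo)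
    have h₁ : N ≤ (oddTwig k).length := by omega
    have h₂ : N ≤ (evenTwig k).length := by omega
    simp only [h12' (by omega), h₁, h₂, Set.mem_ofPred_eq, Set.mem_insert_iff,
      Set.mem_singleton_iff, true_and, or_self, or_assoc]
  · refine (congrArg Set.ncard (Set.ext fun w => ?_)).trans (card₃ _ _ _ h01 h0e he1)
    have h₁ : ¬ N ≤ (oddTwig k).length := by omega
    have h₂ : N ≤ (evenTwig k).length := by omega
    simp only [h12' (by omega), h₁, h₂, Set.mem_ofPred_eq, Set.mem_insert_iff,
      Set.mem_singleton_iff, true_and, false_and, false_or, or_self, or_assoc]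
  · refine (congrArg Set.ncard (Set.ext fun w => ?_)).trans
      (card₄ _ _ _ _ h01 h02 h0e (h12 h) he1 he2)
    have h₁ : ¬ N ≤ (oddTwig k).length := by omega
    have h₂ : N ≤ (evenTwig k).length := by omega
    simp only [h₁, h₂, Set.mem_ofPred_eq, Set.mem_insert_iff, Set.mem_singleton_iff,
      true_and, false_and, false_or, or_assoc]
  · refine (congrArg Set.ncard (Set.ext fun w => ?_)).trans (card₃ _ _ _ h01 h02 (h12 (by omega)))
    have h₁ : ¬ N ≤ (oddTwig k).length := by omega
    have h₂ : ¬ N ≤ (evenTwig k).length := by omega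
    simp only [h₁, h₂, Set.mem_ofPred_eq, Set.mem_insert_iff, Set.mem_singleton_iff,
      false_and, or_false]

/-! ### Complexity of the three-letter word -/

instance : Finite Letter := by
  refine Finite.of_injective (fun c : Letter => (decide (c = a₀), decide (c = a₁))) ?_
  intro c d
  cases c <;> cases d <;> simp

/-- The factors of length `n`, written from right to left. -/
def factorSet (n : ℕ) : Set (List Letter) := {w | Lang w ∧ w.length = n}

lemma finite_of_length {S : Set (List Letter)} (n : ℕ) (h : ∀ w ∈ S, w.length = n) : S.Finite :=
  (List.finite_length_eq Letter n).subset h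

lemma Lang.exists_cons {w : List Letter} (h : Lang w) : ∃ c, Lang (c :: w) := by
  obtain ⟨n, hn⟩ := h
  obtain ⟨s, t, hst⟩ := hn.trans (stdWord_suffix_succ n).isInfix
  rcases List.eq_nil_or_concat s with rfl | ⟨s, c, rfl⟩
  · exact ⟨hole n, n + 2, stdWord n, t, by simp [stdWord_add_two, ← hst]⟩
  · exact ⟨c, n + 1, s, t, by simp [← hst]⟩

/-- The factors `c :: w` of length `n + 1` are counted according to `c = a₀` or `c ≠ a₀`. In both
cases `w` determines `c`, every `w` arises, and the special ones arise twice. -/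
lemma ncard_factorSet_succ {n : ℕ} (hn : 3 ≤ n) :
    (factorSet (n + 1)).ncard = (factorSet n).ncard + {w | Special w ∧ w.length = n}.ncard := by
  set X : Set (List Letter) := {w | Lang (a₀ :: w) ∧ w.length = n}
  set Y : Set (List Letter) := {w | (Lang (a₁ :: w) ∨ Lang (b :: w)) ∧ w.length = n}
  set Y' : Set (List Letter) := {w | (Lang w ∧ w.head? ≠ some a₀) ∧ w.length = n + 1}
  have hXf : X.Finite := finite_of_length n fun w hw => hw.2
  have hYf : Y.Finite := finite_of_length n fun w hw => hw.2
  have hY'f : Y'.Finite := finite_of_length (n + 1) fun w hw => hw.2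
  have hunion : X ∪ Y = factorSet n := by
    ext w
    constructor
    · rintro (⟨h, hl⟩ | ⟨h | h, hl⟩) <;> exact ⟨h.of_cons, hl⟩
    · rintro ⟨h, hl⟩
      obtain ⟨c, hc⟩ := h.exists_cons
      cases c
      exacts [.inl ⟨hc, hl⟩, .inr ⟨.inl hc, hl⟩, .inr ⟨.inr hc, hl⟩]
  have hinter : X ∩ Y = {w | Special w ∧ w.length = n} := by
    ext w
    exact ⟨fun h => ⟨⟨h.1.1, h.2.1⟩, h.1.2⟩, fun h => ⟨⟨h.1.1, h.2⟩, h.1.2, h.2⟩⟩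
  have hsucc : factorSet (n + 1) = (a₀ :: ·) '' X ∪ Y' := by
    ext w
    constructor
    · rintro ⟨h, hl⟩
      rcases w with _ | ⟨c, w⟩
      · simp at hl
      by_cases hc : c = a₀
      · subst hc
        exact .inl ⟨w, ⟨h, by simpa using hl⟩, rfl⟩
      · exact .inr ⟨⟨h, by simpa using hc⟩, hl⟩
    · rintro (⟨w, ⟨h, hl⟩, rfl⟩ | ⟨⟨h, -⟩, hl⟩)
      · exact ⟨h, by simpa using hl⟩
      · exact ⟨h, hl⟩
  have hdisj : Disjoint ((a₀ :: ·) '' X) Y' := by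
    rw [Set.disjoint_left]
    rintro _ ⟨w, -, rfl⟩ ⟨⟨-, h⟩, -⟩
    simp at h
  have htail : List.tail '' Y' = Y := by
    ext w
    constructor
    · rintro ⟨w, ⟨⟨h, hc⟩, hl⟩, rfl⟩
      rcases w with _ | ⟨c, w⟩
      · simp at hl
      refine ⟨?_, by simpa using hl⟩
      cases c
      exacts [absurd rfl hc, .inl h, .inr h]
    · rintro ⟨h | h, hl⟩
      · exact ⟨a₁ :: w, ⟨⟨h, by simp⟩, by simpa using hl⟩, rfl⟩
      · exact ⟨b :: w, ⟨⟨h, by simp⟩, by simpa using hl⟩, rfl⟩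
  have hinj : Set.InjOn List.tail Y' := by
    rintro v ⟨⟨hv, hvc⟩, hvl⟩ w ⟨⟨hw, hwc⟩, hwl⟩ hvw
    rcases v with _ | ⟨c, v⟩
    · simp at hvl
    rcases w with _ | ⟨d, w⟩
    · simp at hwl
    obtain rfl : v = w := hvw
    have hl : 3 ≤ v.length := by simp at hvl; omega
    cases c <;> cases d <;> simp at hvc hwc ⊢
    · exact not_lang_a₁_b hl hv hw
    · exact not_lang_a₁_b hl hw hv
  rw [hsucc, Set.ncard_union_eq hdisj (hXf.image _) hY'f,
    Set.ncard_image_of_injective _ (List.cons_injective), ← hinj.ncard_image, htail,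
    ← hunion, ← hinter, Set.ncard_union_add_ncard_inter X Y hXf hYf]

/-- The difference of `ftm` that a letter stands for. -/
def code : Letter → ZMod 2
  | a₀ => 0
  | a₁ => 1
  | b => 1

set_option maxRecDepth 100000 in
/-- A factor of length at least 4 can be recovered from the differences. -/
lemma code_injective {v w : List Letter} (hv : Lang v) (hw : Lang w) (hl : 4 ≤ v.length)
    (h : v.map code = w.map code) : v = w := by
  have hlen : v.length = w.length := by simpa using congrArg List.length h
  induction v generalizing w with
  | nil => simp at hl
  | cons c v ih =>
    rcases w with _ | ⟨d, w⟩
    · simp at hlen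
    rcases hl.eq_or_lt with hl | hl
    · have key : ∀ v ∈ shortFactors 4, ∀ w ∈ shortFactors 4, v.map code = w.map code → v = w := by
        decide +kernel
      have hv' := hv.mem_shortFactors (by omega)
      have hw' := hw.mem_shortFactors (by omega)
      rw [← hlen] at hw'
      rw [← hl] at hv' hw'
      exact key _ hv' _ hw' h
    · simp only [List.length_cons, List.map_cons, List.cons.injEq] at hl h hlen
      obtain rfl := ih hv.of_cons hw.of_cons (by omega) h.2 (by omega)
      have h1 := h.1
      have hc : ∀ c d : Letter, code c = code d → c = d ∨ (c = a₁ ∧ d = b) ∨ (c = b ∧ d = a₁) := by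
        intro c d; cases c <;> cases d <;> decide
      rcases hc c d h1 with rfl | ⟨rfl, rfl⟩ | ⟨rfl, rfl⟩
      · rfl
      · exact (not_lang_a₁_b (by omega) hv hw).elim
      · exact (not_lang_a₁_b (by omega) hw hv).elim

/-! ### The Fibonacci–Thue–Morse sequence and its differences -/

lemma ftm_fib_add {k j : ℕ} (h : j < Nat.fib (k + 1)) :
    ftm (Nat.fib (k + 2) + j) = ftm j + 1 := by
  have hpos : 0 < Nat.fib (k + 2) + j := by
    have := Nat.fib_pos.2 (show 0 < k + 2 by omega)
    omega
  have hg : Nat.greatestFib (Nat.fib (k + 2) + j) = k + 2 := by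
    apply le_antisymm
    · rw [← Nat.lt_succ_iff, Nat.greatestFib_lt]
      have := Nat.fib_add_two (n := k + 1)
      simp only [add_assoc, Nat.reduceAdd, Nat.succ_eq_add_one] at *
      omega
    · exact Nat.le_greatestFib.2 (Nat.le_add_right _ _)
  rw [ftm, Nat.zeckendorf_of_pos hpos, hg, Nat.add_sub_cancel_left, List.length_cons, ftm]
  push_cast
  rfl

/-- The sequence of differences of `ftm`. -/
def diff (i : ℕ) : ZMod 2 := ftm (i + 1) - ftm i

lemma diff_fib_add {k j : ℕ} (h : j + 1 < Nat.fib (k + 1)) :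
    diff (Nat.fib (k + 2) + j) = diff j := by
  rw [diff, diff, add_assoc, ftm_fib_add h, ftm_fib_add (by omega)]
  ring

lemma ftm_fib_sub_one (n : ℕ) :
    ftm (Nat.fib (n + 4) - 1) = ftm (Nat.fib (n + 2) - 1) + 1 := by
  have h := Nat.fib_pos.2 (show 0 < n + 2 by omega)
  rw [show Nat.fib (n + 4) - 1 = Nat.fib (n + 1 + 2) + (Nat.fib (n + 2) - 1) by
    rw [Nat.fib_add_two (n := n + 2)]; simp only [add_assoc, Nat.reduceAdd]; omega]
  exact ftm_fib_add (by simp only [add_assoc, Nat.reduceAdd]; omega)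

lemma diff_fib_sub_one (n : ℕ) : diff (Nat.fib (n + 3) - 1) = code (hole n) := by
  have hdiff : ∀ n, diff (Nat.fib (n + 3) - 1) = 1 - ftm (Nat.fib (n + 3) - 1) := by
    intro n
    have h := Nat.fib_pos.2 (show 0 < n + 3 by omega)
    have h' : ftm (Nat.fib (n + 3)) = 1 := by simp [ftm]
    rw [diff, Nat.sub_add_cancel h, h']
  rw [hdiff]
  have h0 : ftm 0 = 0 := by simp [ftm]
  have h1 : ftm 1 = 1 := by simpa [h0, Nat.fib] using ftm_fib_add (k := 0) (j := 0) (by decide)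
  induction n using hole.induct with
  | case1 => simp [Nat.fib, h1, hole, code]
  | case2 => rw [ftm_fib_sub_one]; simp [h0, hole, code]
  | case3 => rw [ftm_fib_sub_one]; simp [Nat.fib, h1, hole, code]
  | case4 => rw [ftm_fib_sub_one, ftm_fib_sub_one]; simp [h0, hole, code]
  | case5 n ih =>
    rw [ftm_fib_sub_one (n + 3), ftm_fib_sub_one (n + 1), hole, ← ih]
    have : (1 + 1 : ZMod 2) = 0 := by decide
    rw [add_assoc (ftm _), this, add_zero]

/-- The standard words encode the differences of `ftm`. -/
lemma map_diff_range (n : ℕ) :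
    ((List.range (Nat.fib (n + 2) - 1)).map diff).reverse = (stdWord n).map code := by
  induction n using Nat.twoStepInduction with
  | zero => rfl
  | one =>
    have h0 : ftm 0 = 0 := by simp [ftm]
    have h1 : ftm 1 = 1 := by simpa [h0, Nat.fib] using ftm_fib_add (k := 0) (j := 0) (by decide)
    simp [Nat.fib, diff, stdWord, code, h0, h1]
  | more n ih₁ ih₂ =>
    have hlen : Nat.fib (n + 2 + 2) - 1 = (Nat.fib (n + 3) - 1) + 1 + (Nat.fib (n + 2) - 1) := by
      have h := Nat.fib_pos.2 (show 0 < n + 2 by omega)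
      have h' := Nat.fib_pos.2 (show 0 < n + 3 by omega)
      rw [Nat.fib_add_two (n := n + 2)]
      simp only [add_assoc, Nat.reduceAdd]
      omega
    have hshift : (List.range (Nat.fib (n + 2) - 1)).map
        (fun j => diff (Nat.fib (n + 3) - 1 + 1 + j)) =
          (List.range (Nat.fib (n + 2) - 1)).map diff := by
      refine List.map_congr_left fun j hj => ?_
      rw [List.mem_range] at hj
      rw [Nat.sub_add_cancel (Nat.fib_pos.2 (by omega))]
      exact diff_fib_add (k := n + 1) (by simp only [add_assoc, Nat.reduceAdd]; omega)
    rw [hlen, List.range_add, List.range_succ]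
    simp only [List.map_append, List.map_map, List.map_cons, List.map_nil, List.reverse_append,
      Function.comp_def, hshift, ih₁, diff_fib_sub_one, stdWord_add_two]
    rw [show n + 3 = n + 1 + 2 by ring, ih₂]
    simp

/-- The block of length `n` of differences starting at `i`, written from right to left. -/
def diffWord (n i : ℕ) : List (ZMod 2) := ((List.range n).map fun t => diff (i + t)).reverse

lemma range_diffWord (n : ℕ) : Set.range (diffWord n) = (List.map code) '' factorSet n := by
  ext u
  constructor
  · rintro ⟨i, rfl⟩
    obtain ⟨k, hk⟩ : ∃ k, i + n ≤ Nat.fib (k + 2) - 1 := by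
      refine ⟨i + n + 5, ?_⟩
      have := Nat.le_fib_self (n := i + n + 5 + 2) (by omega)
      omega
    have hword := map_diff_range k
    obtain ⟨r, hr⟩ := Nat.exists_eq_add_of_le hk
    rw [hr, List.range_add, List.range_add] at hword
    simp only [List.map_append, List.map_map, List.reverse_append, Function.comp_def] at hword
    obtain ⟨s, t, hst, -, ht⟩ := List.map_eq_append_iff.1 hword.symm
    obtain ⟨w, t', rfl, hw, -⟩ := List.map_eq_append_iff.1 ht
    refine ⟨w, ⟨⟨k, s, t', by simp [hst]⟩, ?_⟩, hw⟩
    simpa using congrArg List.length hw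
  · rintro ⟨w, ⟨⟨k, s, t, hst⟩, rfl⟩, rfl⟩
    have hword := map_diff_range k
    have hlen : Nat.fib (k + 2) - 1 = t.length + w.length + s.length := by
      have := congrArg List.length hword
      simp [← hst] at this
      omega
    refine ⟨t.length, ?_⟩
    rw [hlen, List.range_add, List.range_add, ← hst] at hword
    simp only [List.map_append, List.map_map, List.reverse_append, Function.comp_def,
      List.append_assoc] at hword
    exact List.append_inj_left (s₁ := diffWord _ _) (List.append_inj_right hword (by simp))
      (by simp [diffWord])

lemma ncard_range_diffWord {n : ℕ} (hn : 4 ≤ n) :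
    (Set.range (diffWord n)).ncard = (factorSet n).ncard := by
  rw [range_diffWord]
  have hinj : Set.InjOn (List.map code) (factorSet n) := fun v hv w hw h =>
    code_injective hv.1 hw.1 (hn.trans_eq hv.2.symm) h
  exact hinj.ncard_image

lemma subwordComplexity_ftm_succ (n : ℕ) :
    subwordComplexity ftm (n + 1) = 2 * (Set.range (diffWord n)).ncard := by
  let f : (Fin (n + 1) → ZMod 2) → ZMod 2 × List (ZMod 2) := fun u =>
    (u 0, (List.ofFn fun t : Fin n => u t.succ - u t.castSucc).reverse)
  have hf : Function.Injective f := by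
    intro u v huv
    obtain ⟨h0, h⟩ := Prod.mk.inj huv
    have h' := List.ofFn_injective (List.reverse_injective h)
    ext1 t
    induction t using Fin.induction with
    | zero => exact h0
    | succ t ih => simpa [ih] using congrFun h' t
  have hblock : ∀ i, f (block ftm (n + 1) i) = (ftm i, diffWord n i) := by
    intro i
    refine Prod.ext rfl ?_
    simp only [f, diffWord, List.reverse_inj]
    rw [List.ofFn_eq_map, ← List.map_coe_finRange_eq_range, List.map_map]
    rfl
  have himage : f '' Set.range (block ftm (n + 1)) = Set.univ ×ˢ Set.range (diffWord n) := by
    ext ⟨p, u⟩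
    constructor
    · rintro ⟨_, ⟨i, rfl⟩, h⟩
      rw [hblock] at h
      obtain ⟨rfl, rfl⟩ := Prod.mk.inj h
      exact ⟨trivial, i, rfl⟩
    · rintro ⟨-, i, rfl⟩
      have hp : ∀ p q : ZMod 2, p = q ∨ p = q + 1 := by decide
      rcases hp p (ftm i) with rfl | rfl
      · exact ⟨_, ⟨i, rfl⟩, hblock i⟩
      -- Moving the block by a large Fibonacci number flips `ftm` and keeps the differences.
      · obtain ⟨k, hk⟩ : ∃ k, i + n < Nat.fib (k + 1) := by
          refine ⟨i + n + 5, ?_⟩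
          have := Nat.le_fib_self (n := i + n + 5 + 1) (by omega)
          omega
        refine ⟨_, ⟨Nat.fib (k + 2) + i, rfl⟩, ?_⟩
        rw [hblock, ftm_fib_add (by omega)]
        refine Prod.ext rfl ?_
        simp only [diffWord, List.reverse_inj]
        refine List.map_congr_left fun t ht => ?_
        rw [List.mem_range] at ht
        rw [add_assoc]
        exact diff_fib_add (by omega)
  rw [subwordComplexity, ← Set.ncard_image_of_injective _ hf, himage, Set.ncard_prod,
    Set.ncard_univ, Nat.card_zmod]

lemma ftmDiff_succ {n : ℕ} (hn : 4 ≤ n) :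
    ftmDiff (n + 1) = 2 * {w | Special w ∧ w.length = n}.ncard := by
  rw [ftmDiff, subwordComplexity_ftm_succ, subwordComplexity_ftm_succ,
    ncard_range_diffWord (by omega), ncard_range_diffWord hn, ncard_factorSet_succ (by omega)]
  push_cast
  ring

end FibThueMorse

open FibThueMorse in
theorem theorem2 (m : ℕ) (hm : 2 ≤ m) :
    (∀ n : ℕ, Nat.fib (2 * m + 1) + 2 ≤ n →
      n ≤ Nat.fib (2 * m + 1) + Nat.fib (2 * m - 2) + 1 → ftmDiff n = 8) ∧
    (∀ n : ℕ, Nat.fib (2 * m + 1) + Nat.fib (2 * m - 2) + 2 ≤ n →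
      n ≤ Nat.fib (2 * m + 2) → ftmDiff n = 6) ∧
    (∀ n : ℕ, Nat.fib (2 * m + 2) + 1 ≤ n →
      n ≤ Nat.fib (2 * m + 2) + Nat.fib (2 * m - 1) → ftmDiff n = 8) ∧
    (∀ n : ℕ, Nat.fib (2 * m + 2) + Nat.fib (2 * m - 1) + 1 ≤ n →
      n ≤ Nat.fib (2 * m + 3) + 1 → ftmDiff n = 6) := by
  obtain ⟨k, rfl⟩ : ∃ k, m = k + 2 := ⟨m - 2, by omega⟩
  rw [show 2 * (k + 2) + 1 = 2 * k + 5 by ring, show 2 * (k + 2) + 2 = 2 * k + 6 by ring,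
    show 2 * (k + 2) + 3 = 2 * k + 7 by ring, show 2 * (k + 2) - 2 = 2 * k + 2 by omega,
    show 2 * (k + 2) - 1 = 2 * k + 3 by omega]
  have f₅ : Nat.fib 5 ≤ Nat.fib (2 * k + 5) := Nat.fib_mono (by omega)
  have f₅' : Nat.fib 5 = 5 := rfl
  have f₂ : Nat.fib (2 * k + 2) ≤ Nat.fib (2 * k + 4) := Nat.fib_mono (by omega)
  have f₃ : Nat.fib (2 * k + 3) ≤ Nat.fib (2 * k + 5) := Nat.fib_mono (by omega)
  have f₆ : Nat.fib (2 * k + 6) = Nat.fib (2 * k + 4) + Nat.fib (2 * k + 5) := Nat.fib_add_two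
  have f₇ : Nat.fib (2 * k + 7) = Nat.fib (2 * k + 5) + Nat.fib (2 * k + 6) := Nat.fib_add_two
  have f₄ : 0 < Nat.fib (2 * k + 4) := Nat.fib_pos.2 (by omega)
  refine ⟨fun n h h' => ?_, fun n h h' => ?_, fun n h h' => ?_, fun n h h' => ?_⟩ <;>
    obtain ⟨N, rfl⟩ : ∃ N, n = N + 1 := ⟨n - 1, by omega⟩ <;>
    rw [ftmDiff_succ (by omega)] <;>
    obtain ⟨h₁, h₂, h₃, h₄⟩ := ncard_special (k := k) (N := N) (by omega) (by omega)
  · rw [h₁ (by omega)]; rfl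
  · rw [h₂ (by omega) (by omega)]; rfl
  · rw [h₃ (by omega) (by omega)]; rfl
  · rw [h₄ (by omega)]; rfl
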